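/- Let $p$ be a prime, let $F$ be a field of characteristic $p$, let $\lambda$ be a partition of $n$, and let $t$ be a $\lambda$-tableau, that is, a bijective filling of the boxes of the Young diagram of $\lambda$ with $1,\dots,n$. Let $S^\lambda$ be the Specht module over $F$: the submodule of the permutation module of $S_n$ on $\lambda$-tabloids (tableaux up to the order of the entries within rows, written $\mathbf{s}$ for a tableau $s$) that is spanned by the polytabloids $e_s=\sum_{g\in C(s)}\operatorname{sgn}(g)\,g\mathbf{s}$, where $s$ runs over all $\lambda$-tableaux and $C(s)$ is the group of permutations fixing the columns of $s$ setwise. Let $H(t)\le S_n$ be the group of all permutations that fix each row of $t$ setwise and permute the columns of $t$ as blocks, each column being sent to a column of equal length. Let $P$ be a Sylow $p$-subgroup of $H(t)$. Then: (i) the Brauer quotient $$S^\lambda(P)=(S^\lambda)^P\Big/\sum_{R<P}\operatorname{Tr}_R^P\,(S^\lambda)^R$$ is nonzero, where $R$ runs over the proper subgroups of $P$ and $\operatorname{Tr}_R^P(x)=\sum_{g\in P/R} g x$; (ii) if $S^\lambda$ is indecomposable, then it has a vertex containing $P$. Here a vertex of an indecomposable $FG$-module $M$, for a finite group $G$, is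 a subgroup $Q$ of $G$ that is minimal among the subgroups for which $M$ is a direct summand of a module induced to $G$ from some indecomposable $FQ$-module (all modules being finite-dimensional). -/

import Mathlib

open scoped MonoidAlgebra

universe u

/-! ### Indecomposable representations, vertices, Brauer quotients -/

namespace Representation

section Vertex

variable {k : Type u} [Field k] {G : Type*} [Group G] {V : Type*} [AddCommGroup V] [Module k V]

/-- A representation is indecomposable if it is nonzero and is not the direct sum of two nonzero
subrepresentations. -/
def IsIndecomposable (ρ : Representation k G V) : Prop :=
  Nontrivial V ∧ ∀ U W : Subrepresentation ρ, IsCompl U W → U = ⊥ ∨ W = ⊥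

/-- `ρ` is (isomorphic to) a direct summand of `σ`. -/
def IsSummand {W : Type*} [AddCommGroup W] [Module k W]
    (ρ : Representation k G V) (σ : Representation k G W) : Prop :=
  ∃ (i : IntertwiningMap ρ σ) (r : IntertwiningMap σ ρ), ∀ v : V, r (i v) = v

/-- `ρ` is a direct summand of a module induced from a (finite-dimensional) indecomposable
module for the subgroup `Q`. -/
def IsSummandOfInduced (ρ : Representation k G V) (Q : Subgroup G) : Prop :=
  ∃ (N : Type u) (_ : AddCommGroup N) (_ : Module k N) (_ : FiniteDimensional k N)
    (σ : Representation k Q N), σ.IsIndecomposable ∧ ρ.IsSummand (ind Q.subtype σ)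

/-- `Q` is a vertex of `ρ`: `ρ` is a summand of a module induced from an indecomposable
`Q`-module, and `Q` is minimal (for inclusion) with this property. -/
def IsVertex (ρ : Representation k G V) (Q : Subgroup G) : Prop :=
  Minimal ρ.IsSummandOfInduced Q

end Vertex

section Brauer

variable {k : Type*} [Field k] {G : Type*} [Group G] {V : Type*} [AddCommGroup V] [Module k V]

/-- The subspace `V ^ Q` of vectors fixed by the subgroup `Q`. -/
noncomputable abbrev fixedBy (ρ : Representation k G V) (Q : Subgroup G) : Submodule k V :=
  invariants (ρ.comp Q.subtype)

/-- On a vector fixed by `R`, only the coset `q R` matters. -/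
theorem apply_out_of_mem_fixedBy (ρ : Representation k G V) {R Q : Subgroup G} {x : V}
    (hx : x ∈ ρ.fixedBy R) (q : Q) :
    ρ ((QuotientGroup.mk q : Q ⧸ R.subgroupOf Q).out : G) x = ρ (q : G) x := by
  obtain ⟨h, hh⟩ := QuotientGroup.mk_out_eq_mul (R.subgroupOf Q) q
  rw [hh, Subgroup.coe_mul, map_mul, Module.End.mul_apply]
  congr 1
  exact hx ⟨_, Subgroup.mem_subgroupOf.1 h.2⟩

variable [Finite G]

/-- The sum of `ρ q` over a transversal for the left cosets `q R` of `R` in `Q`. -/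
noncomputable def transversalSum (ρ : Representation k G V) (R Q : Subgroup G) : V →ₗ[k] V :=
  letI : Fintype (Q ⧸ R.subgroupOf Q) := Fintype.ofFinite _
  ∑ c : Q ⧸ R.subgroupOf Q, ρ (c.out : G)

theorem transversalSum_mem (ρ : Representation k G V) (R Q : Subgroup G) {x : V}
    (hx : x ∈ ρ.fixedBy R) : ρ.transversalSum R Q x ∈ ρ.fixedBy Q := by
  let : Fintype (Q ⧸ R.subgroupOf Q) := Fintype.ofFinite _
  intro q
  simp only [transversalSum, LinearMap.sum_apply, map_sum, MonoidHom.comp_apply,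
    Subgroup.coe_subtype]
  refine Fintype.sum_equiv (MulAction.toPerm q) _ _ fun c => ?_
  have h : MulAction.toPerm q c = (QuotientGroup.mk (q * c.out) : Q ⧸ R.subgroupOf Q) := by
    conv_lhs => rw [← QuotientGroup.out_eq' c]
    rfl
  rw [h, apply_out_of_mem_fixedBy ρ hx, Subgroup.coe_mul, map_mul, Module.End.mul_apply]

/-- The relative trace map `V ^ R → V ^ Q`, which sends `x` to the sum of the vectors `q x` for
`q` in a transversal for the left cosets of `R` in `Q`. (It is used for `R ≤ Q`.) -/
noncomputable def relTrace (ρ : Representation k G V) (R Q : Subgroup G) :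
    ρ.fixedBy R →ₗ[k] ρ.fixedBy Q :=
  (ρ.transversalSum R Q).restrict fun _ hx => ρ.transversalSum_mem R Q hx

/-- The Brauer quotient `V(Q)`: the quotient of `V ^ Q` by the sum of the images of the relative
trace maps from all proper subgroups of `Q`. -/
abbrev BrauerQuotient (ρ : Representation k G V) (Q : Subgroup G) : Type _ :=
  ρ.fixedBy Q ⧸ ⨆ R : {R : Subgroup G // R < Q}, LinearMap.range (ρ.relTrace R Q)

end Brauer

end Representation

/-! ### Tableaux, tabloids and Specht modules -/

/-- The Young diagram of a partition. The cell in row `i` and column `j` is `(i, j)`. -/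
def Nat.Partition.diagram {n : ℕ} (lam : n.Partition) : YoungDiagram :=
  YoungDiagram.ofRowLens (lam.parts.sort (· ≥ ·)) (Multiset.pairwise_sort _ _).sortedGE

/-- A `μ`-tableau: a bijective filling of the cells of `μ` with the `n` elements of `Fin n`. -/
abbrev YoungTableau (μ : YoungDiagram) (n : ℕ) : Type :=
  {c : ℕ × ℕ // c ∈ μ} ≃ Fin n

namespace YoungTableau

variable {μ : YoungDiagram} {n : ℕ}

/-- The row of `t` that contains the entry `x`. -/
def rowOf (t : YoungTableau μ n) (x : Fin n) : ℕ := (t.symm x).1.1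

/-- The column of `t` that contains the entry `x`. -/
def colOf (t : YoungTableau μ n) (x : Fin n) : ℕ := (t.symm x).1.2

/-- The symmetric group acts on tableaux by permuting the entries. -/
instance : MulAction (Equiv.Perm (Fin n)) (YoungTableau μ n) where
  smul g t := t.trans g
  one_smul _ := rfl
  mul_smul _ _ _ := rfl

theorem rowOf_smul (g : Equiv.Perm (Fin n)) (t : YoungTableau μ n) (x : Fin n) :
    (g • t).rowOf x = t.rowOf (g⁻¹ x) := rfl

theorem colOf_smul (g : Equiv.Perm (Fin n)) (t : YoungTableau μ n) (x : Fin n) :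
    (g • t).colOf x = t.colOf (g⁻¹ x) := rfl

/-- The row stabiliser of `t`: the permutations that fix setwise the rows of `t`. -/
def rowStabilizer (t : YoungTableau μ n) : Subgroup (Equiv.Perm (Fin n)) where
  carrier := {g | ∀ x, t.rowOf (g x) = t.rowOf x}
  one_mem' _ := rfl
  mul_mem' {a b} ha hb x := (ha (b x)).trans (hb x)
  inv_mem' {a} ha x := by simpa using (ha (a⁻¹ x)).symm

/-- The group `C(t)`: the permutations that fix setwise the columns of `t`. -/
def columnStabilizer (t : YoungTableau μ n) : Subgroup (Equiv.Perm (Fin n)) where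
  carrier := {g | ∀ x, t.colOf (g x) = t.colOf x}
  one_mem' _ := rfl
  mul_mem' {a b} ha hb x := (ha (b x)).trans (hb x)
  inv_mem' {a} ha x := by simpa using (ha (a⁻¹ x)).symm

instance (t : YoungTableau μ n) (g : Equiv.Perm (Fin n)) : Decidable (g ∈ t.columnStabilizer) :=
  inferInstanceAs (Decidable (∀ x, t.colOf (g x) = t.colOf x))

/-- The group `H(t)`: the permutations in the row stabiliser of `t` that permute the columns of
`t` as blocks, each column going to a column of equal length. Here `s` is the permutation of the
(indices of the) columns. -/
def blockStabilizer (t : YoungTableau μ n) : Subgroup (Equiv.Perm (Fin n)) where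
  carrier := {g | g ∈ t.rowStabilizer ∧ ∃ s : Equiv.Perm ℕ,
    (∀ j, μ.colLen (s j) = μ.colLen j) ∧ ∀ x, t.colOf (g x) = s (t.colOf x)}
  one_mem' := ⟨one_mem _, 1, fun _ => rfl, fun _ => rfl⟩
  mul_mem' := by
    rintro a b ⟨ha, s, hs, has⟩ ⟨hb, s', hs', hbs⟩
    exact ⟨mul_mem ha hb, s * s', fun j => (hs (s' j)).trans (hs' j),
      fun x => (has (b x)).trans (congrArg s (hbs x))⟩
  inv_mem' := by
    rintro a ⟨ha, s, hs, has⟩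
    refine ⟨inv_mem ha, s⁻¹, fun j => by simpa using (hs (s⁻¹ j)).symm, fun x => ?_⟩
    rw [Equiv.Perm.eq_inv_iff_eq, ← has (a⁻¹ x)]
    simp

/-- Two tableaux are row equivalent if they agree up to the order of the entries within rows. -/
def rowSetoid (μ : YoungDiagram) (n : ℕ) : Setoid (YoungTableau μ n) where
  r s t := ∀ x, s.rowOf x = t.rowOf x
  iseqv := ⟨fun _ _ => rfl, fun h x => (h x).symm, fun h h' x => (h x).trans (h' x)⟩

end YoungTableau

/-- Tabloids: tableaux up to the order of the entries within rows. -/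
def YoungTabloid (μ : YoungDiagram) (n : ℕ) : Type :=
  Quotient (YoungTableau.rowSetoid μ n)

namespace YoungTabloid

variable {μ : YoungDiagram} {n : ℕ}

/-- The tabloid of a tableau. -/
def mk (t : YoungTableau μ n) : YoungTabloid μ n := Quotient.mk (YoungTableau.rowSetoid μ n) t

/-- The action of the symmetric group on tabloids induced by the action on tableaux. -/
instance : MulAction (Equiv.Perm (Fin n)) (YoungTabloid μ n) where
  smul g := Quotient.map (g • ·) fun _ _ h x => h (g⁻¹ x)
  one_smul := by rintro ⟨t⟩; rfl
  mul_smul := by rintro g h ⟨t⟩; rfl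

theorem smul_mk (g : Equiv.Perm (Fin n)) (t : YoungTableau μ n) : g • mk t = mk (g • t) := rfl

end YoungTabloid

section Specht

variable (F : Type*) [Field F]

/-- The Young permutation module: the permutation representation of the symmetric group on the
vector space with the tabloids as a basis. -/
noncomputable abbrev youngPermutationRep (μ : YoungDiagram) (n : ℕ) :
    Representation F (Equiv.Perm (Fin n)) F[YoungTabloid μ n] :=
  Representation.ofMulAction F (Equiv.Perm (Fin n)) (YoungTabloid μ n)

variable {μ : YoungDiagram} {n : ℕ}

/-- The polytabloid of `t`: the sum of `sgn(g) g {t}` over the column stabiliser of `t`, where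
`{t}` is the tabloid of `t`. -/
noncomputable def polytabloid (t : YoungTableau μ n) : F[YoungTabloid μ n] :=
  ∑ g : Equiv.Perm (Fin n) with g ∈ t.columnStabilizer,
    MonoidAlgebra.single (g • YoungTabloid.mk t) (((Equiv.Perm.sign g : ℤˣ) : ℤ) : F)

theorem youngPermutationRep_polytabloid (h : Equiv.Perm (Fin n)) (t : YoungTableau μ n) :
    youngPermutationRep F μ n h (polytabloid F t) = polytabloid F (h • t) := by
  simp only [polytabloid, map_sum, Representation.ofMulAction_single]
  refine Finset.sum_equiv (MulAut.conj h).toEquiv (fun g => ?_) (fun g _ => ?_)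
  · simp only [Finset.mem_filter, Finset.mem_univ, true_and]
    change (∀ x, _) ↔ (∀ x, _)
    simp only [YoungTableau.colOf_smul]
    refine ⟨fun H x => by simpa using H (h⁻¹ x), fun H x => by simpa using H (h x)⟩
  · have hs : Equiv.Perm.sign (MulAut.conj h g) = Equiv.Perm.sign g := by
      simp [mul_right_comm _ _ (Equiv.Perm.sign h)]
    change _ = MonoidAlgebra.single ((h * g * h⁻¹) • YoungTabloid.mk (h • t))
      (((Equiv.Perm.sign (MulAut.conj h g) : ℤˣ) : ℤ) : F)
    rw [hs]
    simp [smul_smul, ← YoungTabloid.smul_mk]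

variable (μ n)

/-- The Specht module: the subrepresentation of the Young permutation module that is spanned by
the polytabloids. -/
noncomputable def spechtModule : Subrepresentation (youngPermutationRep F μ n) where
  toSubmodule := Submodule.span F (Set.range (polytabloid F (μ := μ) (n := n)))
  apply_mem_toSubmodule g v hv := by
    induction hv using Submodule.span_induction with
    | mem x hx =>
      obtain ⟨t, rfl⟩ := hx
      rw [youngPermutationRep_polytabloid]
      exact Submodule.subset_span ⟨_, rfl⟩
    | zero => simp
    | add x y _ _ hx hy => rw [map_add]; exact add_mem hx hy
    | smul a x _ hx => rw [map_smul]; exact Submodule.smul_mem _ a hx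

end Specht

/-- The Specht module of the partition `lam` of `n` over `F`, as a representation of the symmetric
group of `Fin n`. -/
noncomputable abbrev spechtRep (F : Type*) [Field F] {n : ℕ} (lam : n.Partition) :
    Representation F (Equiv.Perm (Fin n)) (spechtModule F lam.diagram n).toSubmodule :=
  (spechtModule F lam.diagram n).toRepresentation

/-! The polytabloid `e_t` survives in the Brauer quotient at `P`, and a linear functional detects
it. Elements of `H(t)` fix the tabloid `{t}` and permute the columns of `t` as blocks, so they
preserve `C(t)` and fix `e_t` without a sign (`polytabloid_smul_of_mem_blockStabilizer`). The
coefficient at `{t}` is a `P`-invariant functional, with value 1 on `e_t` (`coeff_polytabloid_mk`).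
An invariant functional multiplies by the index `[P : R]` on traces from `R`; for proper `R` this is
divisible by `p`, so all such traces are killed
(`nontrivial_brauerQuotient_of_invariant_functional`).

For the vertex, let the module be a summand of one induced from `Q`. Splitting the induced module by
cosets writes a `P`-fixed vector as a sum indexed by `G ⧸ Q` whose terms `P` permutes. If no
conjugate of `Q` contained `P`, no coset would be fixed by `P`, and grouping by orbits would give
traces from proper subgroups, hence a zero Brauer quotient (`IsSummandOfInduced.exists_le_conj`).
Conjugates of vertices are vertices, so some vertex contains `P`. -/

namespace Representation

/-! ### Induced modules as coinvariants. -/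

section Induced

variable {k G H A B : Type*} [Field k] [Group G] [Group H] (φ : G →* H)
  [AddCommGroup A] [Module k A] (ρ : Representation k G A) [AddCommGroup B] [Module k B]

theorem IndV.mk_mul_apply (g : G) (h : H) (a : A) :
    IndV.mk φ ρ (φ g * h) (ρ g a) = IndV.mk φ ρ h a := by
  have := Coinvariants.mk_self_apply (ρ := Representation.tprod ((leftRegular k H).comp φ) ρ) g
    (MonoidAlgebra.single h 1 ⊗ₜ[k] a)
  simpa [ofMulAction_single] using this

/-- The linear map out of an induced module given by a compatible family of linear maps. -/
noncomputable def IndV.lift (f : H → A →ₗ[k] B)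
    (hf : ∀ g h a, f (φ g * h) (ρ g a) = f h a) : IndV φ ρ →ₗ[k] B :=
  Coinvariants.lift _
    (TensorProduct.lift (Finsupp.linearCombination k f ∘ₗ
      (MonoidAlgebra.coeffLinearEquiv k).toLinearMap)) fun g => by
    refine TensorProduct.ext <| MonoidAlgebra.lhom_ext' fun h => LinearMap.ext_ring ?_
    ext a
    simpa [ofMulAction_single] using hf g h a

@[simp]
theorem IndV.lift_mk (f : H → A →ₗ[k] B) (hf : ∀ g h a, f (φ g * h) (ρ g a) = f h a)
    (h : H) (a : A) : IndV.lift φ ρ f hf (IndV.mk φ ρ h a) = f h a := by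
  simp [IndV.lift]

variable {φ ρ} in
theorem IndV.induction_on {motive : IndV φ ρ → Prop} (x : IndV φ ρ)
    (mk : ∀ h a, motive (IndV.mk φ ρ h a)) (zero : motive 0)
    (add : ∀ x y, motive x → motive y → motive (x + y)) : motive x := by
  induction x using Coinvariants.induction_on with
  | h v =>
  induction v using TensorProduct.induction_on with
  | zero => simpa using zero
  | add x y hx hy => simpa using add _ _ hx hy
  | tmul x a =>
    induction x using MonoidAlgebra.induction_linear with
    | zero => simpa using zero
    | add x y hx hy => simpa [TensorProduct.add_tmul] using add _ _ hx hy
    | single h r =>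
      have := mk h (r • a)
      rwa [LinearMap.comp_apply, TensorProduct.mk_apply, ← TensorProduct.smul_tmul,
        MonoidAlgebra.smul_single, smul_eq_mul, mul_one] at this

end Induced

/-! ### Decomposition of an induced module by cosets. -/

section CosetProjection

open scoped Classical in
/-- The projection of a module induced from `Q` to its summand labelled by the left coset `ω`
of `Q`. -/
noncomputable def indCosetProj {k G A : Type*} [Field k] [Group G] (Q : Subgroup G)
    [AddCommGroup A] [Module k A] (σ : Representation k Q A) (ω : G ⧸ Q) :
    IndV Q.subtype σ →ₗ[k] IndV Q.subtype σ :=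
  -- In `mk h a` the element `h` matters up to left multiplication by `Q`, and `g` replaces it by `h
  -- * g⁻¹`. Hence the coset `h⁻¹ Q` is well defined and moves by left translation.
  IndV.lift _ _ (fun h => if (QuotientGroup.mk h⁻¹ : G ⧸ Q) = ω then IndV.mk _ _ h else 0)
    fun q h a => by
      have : (QuotientGroup.mk (Q.subtype q * h)⁻¹ : G ⧸ Q) = QuotientGroup.mk h⁻¹ := by
        rw [mul_inv_rev]
        exact QuotientGroup.mk_mul_of_mem _ (inv_mem q.2)
      rw [this]
      split_ifs
      · exact IndV.mk_mul_apply _ _ _ _ _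
      · rfl

variable {k G A : Type*} [Field k] [Group G] (Q : Subgroup G)
    [AddCommGroup A] [Module k A] (σ : Representation k Q A)

open scoped Classical in
theorem indCosetProj_mk (ω : G ⧸ Q) (h : G) (a : A) :
    indCosetProj Q σ ω (IndV.mk _ _ h a) =
      if (QuotientGroup.mk h⁻¹ : G ⧸ Q) = ω then IndV.mk Q.subtype σ h a else 0 := by
  rw [indCosetProj, IndV.lift_mk]
  split_ifs <;> rfl

theorem ind_indCosetProj (g : G) (ω : G ⧸ Q) (x : IndV Q.subtype σ) :
    ind Q.subtype σ g (indCosetProj Q σ ω x) =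
      indCosetProj Q σ (g • ω) (ind Q.subtype σ g x) := by
  classical
  induction x using IndV.induction_on with
  | zero => simp only [map_zero]
  | add x y hx hy => simp only [map_add, hx, hy]
  | mk h a =>
    have hiff : (QuotientGroup.mk (h * g⁻¹)⁻¹ : G ⧸ Q) = g • ω ↔ QuotientGroup.mk h⁻¹ = ω := by
      rw [mul_inv_rev, inv_inv, ← smul_eq_mul, ← MulAction.Quotient.smul_mk, smul_left_cancel_iff]
    rw [ind_mk, indCosetProj_mk, indCosetProj_mk]
    simp only [hiff]
    split_ifs
    · rw [ind_mk]
    · rw [map_zero]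

theorem sum_indCosetProj [Fintype (G ⧸ Q)] (x : IndV Q.subtype σ) :
    ∑ ω, indCosetProj Q σ ω x = x := by
  classical
  induction x using IndV.induction_on with
  | zero => simp only [map_zero, Finset.sum_const_zero]
  | add x y hx hy => simp only [map_add, Finset.sum_add_distrib, hx, hy]
  | mk h a => simp only [indCosetProj_mk, Finset.sum_ite_eq, Finset.mem_univ, if_true]

end CosetProjection

/-! ### Direct summands of induced modules. -/

section Summand

variable {k : Type*} [Field k] {G : Type*} [Group G] {V W X : Type*}
  [AddCommGroup V] [Module k V] [AddCommGroup W] [Module k W] [AddCommGroup X] [Module k X]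
  {ρ : Representation k G V} {σ : Representation k G W} {τ : Representation k G X}

theorem IsSummand.trans (h : ρ.IsSummand σ) (h' : σ.IsSummand τ) : ρ.IsSummand τ := by
  obtain ⟨i, r, hir⟩ := h
  obtain ⟨j, s, hjs⟩ := h'
  exact ⟨j.comp i, r.comp s, fun v => by simp [hir, hjs]⟩

theorem isSummand_ind_top (ρ : Representation k G V) :
    ρ.IsSummand (ind (⊤ : Subgroup G).subtype (ρ.comp (⊤ : Subgroup G).subtype)) := by
  refine ⟨(IndV.mk _ _ 1).intertwiningMap_of_isIntertwiningMap _ _ fun g v => ?_,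
    (IndV.lift _ _ (fun h => ρ h⁻¹) fun q h a => ?_).intertwiningMap_of_isIntertwiningMap _ _
      fun g x => ?_, fun v => ?_⟩
  · rw [ind_mk, one_mul, ← IndV.mk_mul_apply _ _ ⟨g, Subgroup.mem_top g⟩ g⁻¹]
    simp
  · simp [← Module.End.mul_apply, ← map_mul]
  · induction x using IndV.induction_on with
    | zero => simp only [map_zero]
    | add x y hx hy => simp only [map_add, hx, hy]
    | mk h a =>
      rw [ind_mk, IndV.lift_mk, IndV.lift_mk, mul_inv_rev, inv_inv, map_mul]
      rfl
  · rw [LinearMap.toIntertwiningMap, LinearMap.toIntertwiningMap, IndV.lift_mk]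
    simp

/-- Conjugating the inducing subgroup and its module does not change the induced module. -/
theorem isSummand_ind_of_conj {Q Q' : Subgroup G} (g : G) (e : Q ≃* Q')
    (he : ∀ q, (e q : G) = g * q * g⁻¹) (σ : Representation k Q W) :
    (ind Q.subtype σ).IsSummand (ind Q'.subtype (σ.comp e.symm.toMonoidHom)) := by
  have he' : ∀ q, (e.symm q : G) = g⁻¹ * q * g := fun q => by
    have := he (e.symm q)
    rw [e.apply_symm_apply] at this
    rw [this]; group
  refine ⟨(IndV.lift _ _ (fun h => IndV.mk _ _ (g * h))
      fun q h a => ?_).intertwiningMap_of_isIntertwiningMap _ _ fun x v => ?_,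
    (IndV.lift _ _ (fun h => IndV.mk _ _ (g⁻¹ * h))
      fun q h a => ?_).intertwiningMap_of_isIntertwiningMap _ _ fun x v => ?_, fun v => ?_⟩
  · rw [← IndV.mk_mul_apply _ _ (e q) (g * h)]
    simp [he, mul_assoc]
  · induction v using IndV.induction_on with
    | zero => simp only [map_zero]
    | add x y hx hy => simp only [map_add, hx, hy]
    | mk h a => simp only [ind_mk, IndV.lift_mk, mul_assoc]
  · rw [← IndV.mk_mul_apply _ _ (e.symm q) (g⁻¹ * h)]
    simp [he', mul_assoc]
  · induction v using IndV.induction_on with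
    | zero => simp only [map_zero]
    | add x y hx hy => simp only [map_add, hx, hy]
    | mk h a => simp only [ind_mk, IndV.lift_mk, mul_assoc]
  · rw [LinearMap.toIntertwiningMap, LinearMap.toIntertwiningMap]
    induction v using IndV.induction_on with
    | zero => simp only [map_zero]
    | add x y hx hy => simp only [map_add, hx, hy]
    | mk h a => simp only [IndV.lift_mk, inv_mul_cancel_left]

end Summand

/-! ### Existence and conjugacy of vertices. -/

section Vertex

variable {k : Type u} [Field k] {G : Type*} [Group G]

/-- Both representations have the same invariant subspaces. This serves for restriction to `⊤` and
for transport to a conjugate subgroup. -/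
theorem IsIndecomposable.comp_of_surjective {H V : Type*} [Group H] [AddCommGroup V] [Module k V]
    {ρ : Representation k G V} (h : ρ.IsIndecomposable) (f : H →* G)
    (hf : Function.Surjective f) : IsIndecomposable (ρ.comp f) := by
  refine ⟨h.1, fun U W hUW => ?_⟩
  let lift (U : Subrepresentation (ρ.comp f)) : Subrepresentation ρ :=
    ⟨U.toSubmodule, fun g v hv => by
      obtain ⟨x, rfl⟩ := hf g
      exact U.apply_mem_toSubmodule x hv⟩
  have hbot : ∀ U, lift U = ⊥ → U = ⊥ := fun U hU =>
    Subrepresentation.toSubmodule_injective (congrArg (Subrepresentation.toSubmodule (ρ := ρ)) hU)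
  have hc : IsCompl (lift U) (lift W) := by
    rw [isCompl_iff, disjoint_iff, codisjoint_iff] at hUW ⊢
    exact ⟨Subrepresentation.toSubmodule_injective
        (congrArg Subrepresentation.toSubmodule hUW.1 :),
      Subrepresentation.toSubmodule_injective
        (congrArg Subrepresentation.toSubmodule hUW.2 :)⟩
  exact (h.2 _ _ hc).imp (hbot U) (hbot W)

theorem IsIndecomposable.isSummandOfInduced_top {V : Type u} [AddCommGroup V] [Module k V]
    [FiniteDimensional k V] {ρ : Representation k G V} (h : ρ.IsIndecomposable) :
    ρ.IsSummandOfInduced ⊤ :=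
  ⟨V, _, _, ‹_›, ρ.comp (⊤ : Subgroup G).subtype,
    h.comp_of_surjective _ fun g => ⟨⟨g, Subgroup.mem_top g⟩, rfl⟩, isSummand_ind_top ρ⟩

theorem IsIndecomposable.exists_isVertex [Finite G] {V : Type u} [AddCommGroup V] [Module k V]
    [FiniteDimensional k V] {ρ : Representation k G V} (h : ρ.IsIndecomposable) :
    ∃ Q, ρ.IsVertex Q := by
  obtain ⟨Q, -, hQ⟩ := exists_minimal_le_of_wellFoundedLT ρ.IsSummandOfInduced ⊤
    h.isSummandOfInduced_top
  exact ⟨Q, hQ⟩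

variable {V : Type*} [AddCommGroup V] [Module k V] {ρ : Representation k G V} {Q : Subgroup G}

open scoped Pointwise

theorem IsSummandOfInduced.conj (h : ρ.IsSummandOfInduced Q) (g : G) :
    ρ.IsSummandOfInduced (MulAut.conj g • Q) := by
  obtain ⟨N, _, _, _, σ, hσ, hs⟩ := h
  let e : Q ≃* (MulAut.conj g • Q : Subgroup G) := Subgroup.equivSMul (MulAut.conj g) Q
  exact ⟨N, _, _, ‹_›, σ.comp e.symm.toMonoidHom,
    hσ.comp_of_surjective _ e.symm.surjective,
    hs.trans (isSummand_ind_of_conj g e (fun _ => rfl) σ)⟩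

theorem IsVertex.conj (h : ρ.IsVertex Q) (g : G) : ρ.IsVertex (MulAut.conj g • Q) := by
  refine ⟨h.1.conj g, fun R hR hle => ?_⟩
  rw [Subgroup.pointwise_smul_subset_iff, ← map_inv]
  refine h.2 (hR.conj g⁻¹) ?_
  rwa [map_inv, ← Subgroup.subset_pointwise_smul_iff]

end Vertex

/-! ### Brauer quotients. -/

section Brauer

variable {k : Type*} [Field k] {G : Type*} [Group G] [Finite G] {V : Type*} [AddCommGroup V]
  [Module k V] {ρ : Representation k G V} {P : Subgroup G}

theorem nontrivial_brauerQuotient_of_invariant_functional {p : ℕ} [Fact p.Prime] [CharP k p]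
    (hP : IsPGroup p P) (l : V →ₗ[k] k) (hl : ∀ g ∈ P, ∀ v, l (ρ g v) = l v) {x : V}
    (hx : x ∈ ρ.fixedBy P) (hlx : l x ≠ 0) : Nontrivial (ρ.BrauerQuotient P) := by
  rw [Submodule.Quotient.nontrivial_iff]
  intro htop
  have hle : ⨆ R : {R : Subgroup G // R < P}, LinearMap.range (ρ.relTrace R P) ≤
      LinearMap.ker (l ∘ₗ (ρ.fixedBy P).subtype) := by
    refine iSup_le fun ⟨R, hR⟩ => ?_
    rintro _ ⟨y, rfl⟩
    -- The index is a power of `p`, and exponent 0 would force `P ≤ R`.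
    have hdvd : p ∣ (R.subgroupOf P).index := by
      obtain ⟨m, hm⟩ := hP.index (R.subgroupOf P)
      rw [hm]
      refine dvd_pow_self p fun h0 => hR.not_ge ?_
      rw [h0, pow_zero] at hm
      exact Subgroup.relIndex_eq_one.1 hm
    let : Fintype (P ⧸ R.subgroupOf P) := Fintype.ofFinite _
    change l (ρ.transversalSum R P y) = 0
    have hs : l (ρ.transversalSum R P y) = ∑ c : P ⧸ R.subgroupOf P, l (ρ (c.out : G) y) := by
      simp only [transversalSum, LinearMap.sum_apply, map_sum]
    rw [hs, Finset.sum_congr rfl fun c _ => hl _ c.out.2 _, Finset.sum_const, Finset.card_univ,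
      ← Nat.card_eq_fintype_card, nsmul_eq_mul]
    change (((R.subgroupOf P).index : ℕ) : k) * _ = 0
    rw [(CharP.cast_eq_zero_iff k p _).2 hdvd, zero_mul]
  rw [htop] at hle
  exact hlx (hle (Submodule.mem_top (x := ⟨x, hx⟩)))

/-- The sum of a `P`-equivariant family of vectors is a sum of traces from the stabilisers. -/
theorem sum_mem_iSup_range_relTrace {Ω : Type*} [Fintype Ω] [MulAction G Ω]
    (hΩ : ∀ ω : Ω, ¬ P ≤ MulAction.stabilizer G ω) (y : Ω → V)
    (hy : ∀ g ∈ P, ∀ ω, ρ g (y ω) = y (g • ω)) {x : ρ.fixedBy P} (hx : (x : V) = ∑ ω, y ω) :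
    x ∈ ⨆ R : {R : Subgroup G // R < P}, LinearMap.range (ρ.relTrace R P) := by
  classical
  let R (ω : Ω) : Subgroup G := MulAction.stabilizer G ω ⊓ P
  have hR (ω : Ω) : R ω < P := lt_of_le_of_ne inf_le_right fun h => hΩ ω (inf_eq_right.1 h)
  have hfix (ω : Ω) : y ω ∈ ρ.fixedBy (R ω) := fun g => by
    change ρ (g : G) (y ω) = y ω
    rw [hy _ g.2.2, (MulAction.mem_stabilizer_iff.1 g.2.1)]
  -- Orbit-stabiliser: the trace of `y ω` from its stabiliser in `P` is the sum of `y` over the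
  -- `P`-orbit of `ω`.
  have hsum (ω : Ω) : ρ.transversalSum (R ω) P (y ω) =
      ∑ ω' with (Quotient.mk'' ω' : MulAction.orbitRel.Quotient P Ω) = Quotient.mk'' ω, y ω' := by
    let : Fintype (P ⧸ (R ω).subgroupOf P) := Fintype.ofFinite _
    have hs : ρ.transversalSum (R ω) P (y ω) =
        ∑ c : P ⧸ (R ω).subgroupOf P, ρ (c.out : G) (y ω) := by
      simp only [transversalSum, LinearMap.sum_apply]
    rw [hs]
    refine Finset.sum_bij (fun c _ => (c.out : G) • ω) ?_ ?_ ?_ ?_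
    · intro c _
      simp only [Finset.mem_filter, Finset.mem_univ, true_and, Quotient.eq'']
      exact ⟨c.out, rfl⟩
    · intro c _ d _ hcd
      rw [← QuotientGroup.out_eq' c, ← QuotientGroup.out_eq' d, QuotientGroup.eq,
        Subgroup.mem_subgroupOf]
      refine ⟨?_, (c.out⁻¹ * d.out).2⟩
      change ((c.out : G)⁻¹ * (d.out : G)) • ω = ω
      rw [mul_smul, ← hcd, inv_smul_smul]
    · intro ω' hω'
      simp only [Finset.mem_filter, Finset.mem_univ, true_and, Quotient.eq''] at hω'
      obtain ⟨q, rfl⟩ := hω'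
      obtain ⟨h, hh⟩ := QuotientGroup.mk_out_eq_mul ((R ω).subgroupOf P) q
      refine ⟨QuotientGroup.mk q, Finset.mem_univ _, ?_⟩
      have hh' := (Subgroup.mem_subgroupOf.1 h.2).1
      rw [hh, Subgroup.coe_mul, mul_smul, MulAction.mem_stabilizer_iff.1 hh']
      rfl
    · exact fun c _ => hy _ c.out.2 ω
  let : Fintype (MulAction.orbitRel.Quotient P Ω) := Fintype.ofFinite _
  have hx' : x = ∑ o : MulAction.orbitRel.Quotient P Ω,
      ρ.relTrace (R o.out) P ⟨y o.out, hfix o.out⟩ := by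
    ext1
    rw [hx, ← Finset.sum_fiberwise Finset.univ
      (fun ω => (Quotient.mk'' ω : MulAction.orbitRel.Quotient P Ω)), AddSubmonoidClass.coe_finsetSum]
    refine Finset.sum_congr rfl fun o _ => ?_
    refine Eq.trans ?_ (hsum o.out).symm
    rw [Quotient.out_eq']
  rw [hx']
  exact sum_mem fun o _ => Submodule.mem_iSup_of_mem ⟨R o.out, hR o.out⟩ ⟨_, rfl⟩

end Brauer

open scoped Pointwise in
/-- A module with a nonzero Brauer quotient at `P` that is a summand of a module induced from `Q`
forces `P` to be contained in a conjugate of `Q`. -/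
theorem IsSummandOfInduced.exists_le_conj {k : Type u} [Field k] {G : Type*} [Group G] [Finite G]
    {V : Type*} [AddCommGroup V] [Module k V] {ρ : Representation k G V} {P Q : Subgroup G}
    (hQ : ρ.IsSummandOfInduced Q) (hP : Nontrivial (ρ.BrauerQuotient P)) :
    ∃ g : G, P ≤ MulAut.conj g • Q := by
  obtain ⟨N, _, _, _, σ, -, i, r, hir⟩ := hQ
  let : Fintype (G ⧸ Q) := Fintype.ofFinite _
  by_contra! hcon
  rw [Submodule.Quotient.nontrivial_iff] at hP
  -- The family consists of the coset components of `i x`, pushed back by `r`; they add up to `r (i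
  -- x) = x`.
  refine hP (eq_top_iff.2 fun x _ => sum_mem_iSup_range_relTrace (Ω := G ⧸ Q) (fun ω hω => ?_)
    (fun ω => r (indCosetProj Q σ ω (i x))) (fun g hg ω => ?_) ?_)
  · induction ω using QuotientGroup.induction_on with
    | H g =>
    refine hcon g ?_
    -- The stabiliser of the coset `g Q` is the conjugate of `Q` by `g`.
    rwa [show (QuotientGroup.mk g : G ⧸ Q) = g • QuotientGroup.mk 1 by
      rw [MulAction.Quotient.smul_mk, smul_eq_mul, mul_one],
      MulAction.stabilizer_smul_eq_stabilizer_map_conj, MulAction.stabilizer_quotient] at hω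
  · have hx : ρ g x = x := x.2 ⟨g, hg⟩
    rw [← r.isIntertwining, ind_indCosetProj, ← i.isIntertwining, hx]
  · rw [← map_sum, sum_indCosetProj, hir]

theorem IsIndecomposable.exists_isVertex_ge {k : Type u} [Field k] {G : Type*} [Group G]
    [Finite G] {V : Type u} [AddCommGroup V] [Module k V] [FiniteDimensional k V]
    {ρ : Representation k G V} (h : ρ.IsIndecomposable) {P : Subgroup G}
    (hP : Nontrivial (ρ.BrauerQuotient P)) : ∃ Q, ρ.IsVertex Q ∧ P ≤ Q := by
  obtain ⟨Q, hQ⟩ := h.exists_isVertex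
  obtain ⟨g, hg⟩ := hQ.1.exists_le_conj hP
  exact ⟨_, hQ.conj g, hg⟩

end Representation

/-! ### Polytabloids. -/

section Specht

variable {μ : YoungDiagram} {n : ℕ}

theorem YoungTabloid.mk_eq_mk {s t : YoungTableau μ n} :
    YoungTabloid.mk s = YoungTabloid.mk t ↔ ∀ x, s.rowOf x = t.rowOf x :=
  Quotient.eq (r := YoungTableau.rowSetoid μ n)

theorem YoungTabloid.smul_mk_eq_self {t : YoungTableau μ n} {g : Equiv.Perm (Fin n)} :
    g • YoungTabloid.mk t = YoungTabloid.mk t ↔ g ∈ t.rowStabilizer := by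
  rw [YoungTabloid.smul_mk, YoungTabloid.mk_eq_mk]
  refine ⟨fun h x => by simpa [YoungTableau.rowOf_smul] using (h (g x)).symm, fun h x => ?_⟩
  simpa [YoungTableau.rowOf_smul] using (h (g⁻¹ x)).symm

theorem YoungTableau.eq_one_of_mem_rowStabilizer_of_mem_columnStabilizer {t : YoungTableau μ n}
    {g : Equiv.Perm (Fin n)} (hr : g ∈ t.rowStabilizer) (hc : g ∈ t.columnStabilizer) : g = 1 :=
  Equiv.ext fun x => t.symm.injective <| Subtype.ext <| Prod.ext (hr x) (hc x)

variable (F : Type*) [Field F]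

/-- Only `g = 1` contributes: a `g` fixing `{t}` preserves rows, and an element preserving all rows
and columns is trivial. -/
theorem coeff_polytabloid_mk (t : YoungTableau μ n) :
    (polytabloid F t).coeff (YoungTabloid.mk t) = 1 := by
  classical
  rw [polytabloid, MonoidAlgebra.coeff_sum, Finsupp.finsetSum_apply, Finset.sum_eq_single 1]
  · simp
  · intro g hg hg1
    rw [MonoidAlgebra.coeff_single, Finsupp.single_eq_of_ne]
    intro h
    exact hg1 (YoungTableau.eq_one_of_mem_rowStabilizer_of_mem_columnStabilizer
      (YoungTabloid.smul_mk_eq_self.1 h.symm) (Finset.mem_filter.1 hg).2)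
  · intro h
    exact absurd (Finset.mem_filter.2 ⟨Finset.mem_univ _, one_mem _⟩) h

theorem polytabloid_smul_of_mem_blockStabilizer {t : YoungTableau μ n} {h : Equiv.Perm (Fin n)}
    (hh : h ∈ t.blockStabilizer) : polytabloid F (h • t) = polytabloid F t := by
  obtain ⟨hr, s, -, hs⟩ := hh
  have hmk : YoungTabloid.mk (h • t) = YoungTabloid.mk t := by
    rw [← YoungTabloid.smul_mk, YoungTabloid.smul_mk_eq_self.2 hr]
  rw [polytabloid, polytabloid, hmk]
  refine Finset.sum_congr (Finset.filter_congr fun g _ => ?_) fun _ _ => rfl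
  -- The columns of `h • t` are those of `t`, relabelled by `s`, so the two column stabilisers
  -- coincide.
  have hcol (x : Fin n) : s ((h • t).colOf x) = t.colOf x := by
    rw [YoungTableau.colOf_smul, ← hs, ← Equiv.Perm.mul_apply, mul_inv_cancel, Equiv.Perm.one_apply]
  change (∀ x, _ = _) ↔ (∀ x, _ = _)
  simp only [← hcol, s.injective.eq_iff]

/-- Needed for the Specht module to be finite-dimensional. -/
instance : Finite (YoungTabloid μ n) :=
  inferInstanceAs (Finite (Quotient (YoungTableau.rowSetoid μ n)))

end Specht

/-! ### The main theorem. -/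

theorem theorem1p1 {n : ℕ} (lam : n.Partition) (t : YoungTableau lam.diagram n)
    (p : ℕ) [Fact p.Prime] (F : Type u) [Field F] [CharP F p]
    (P : Sylow p t.blockStabilizer) :
    Nontrivial ((spechtRep F lam).BrauerQuotient
      ((P : Subgroup t.blockStabilizer).map t.blockStabilizer.subtype)) ∧
    ((spechtRep F lam).IsIndecomposable →
      ∃ Q : Subgroup (Equiv.Perm (Fin n)), (spechtRep F lam).IsVertex Q ∧
        (P : Subgroup t.blockStabilizer).map t.blockStabilizer.subtype ≤ Q) := by
  have hle : (P : Subgroup t.blockStabilizer).map t.blockStabilizer.subtype ≤ t.blockStabilizer :=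
    Subgroup.map_subtype_le _
  -- The coefficient at `{t}`, invariant under `P` because `P` lies in the row stabiliser.
  let l : (spechtModule F lam.diagram n).toSubmodule →ₗ[F] F :=
    Finsupp.lapply (YoungTabloid.mk t) ∘ₗ (MonoidAlgebra.coeffLinearEquiv F).toLinearMap ∘ₗ
      (spechtModule F lam.diagram n).toSubmodule.subtype
  have hnt : Nontrivial ((spechtRep F lam).BrauerQuotient
      ((P : Subgroup t.blockStabilizer).map t.blockStabilizer.subtype)) := by
    refine Representation.nontrivial_brauerQuotient_of_invariant_functional (p := p)
      (P.isPGroup'.map _) l (fun g hg v => ?_)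
      (x := ⟨polytabloid F t, Submodule.subset_span ⟨t, rfl⟩⟩) (fun g => ?_) ?_
    · change (youngPermutationRep F _ n g v).coeff (YoungTabloid.mk t) =
        (v : F[YoungTabloid _ n]).coeff (YoungTabloid.mk t)
      rw [Representation.coeff_ofMulAction,
        YoungTabloid.smul_mk_eq_self.2 (inv_mem (hle hg).1)]
    · refine Subtype.ext ?_
      change youngPermutationRep F _ n g (polytabloid F t) = polytabloid F t
      rw [youngPermutationRep_polytabloid, polytabloid_smul_of_mem_blockStabilizer F (hle g.2)]
    · change (polytabloid F t).coeff (YoungTabloid.mk t) ≠ 0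
      rw [coeff_polytabloid_mk]
      exact one_ne_zero
  exact ⟨hnt, fun h => h.exists_isVertex_ge hnt⟩
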